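/- Fix a bijection $\langle\cdot,\cdot\rangle:\mathbb N\times\mathbb N\to\mathbb N$, let $e_m$ denote the finite set $\{k_1,\dots,k_r\}$ with $m=2^{k_1}+\cdots+2^{k_r}$ (the $k_i$ distinct), and let $\mathcal S$ be Scott's graph model: the set $\mathcal P(\mathbb N)$ with the application $UV=\{n\mid \exists m,\ e_m\subseteq V\text{ and }\langle m,n\rangle\in U\}$ and the pairing $\mathsf pUV=\{2n\mid n\in U\}\cup\{2n+1\mid n\in V\}$. Let $\mathsf{RT}(\mathcal S)$ be the realizability topos over $\mathcal S$ (the Scott realizability topos): its objects are sets $X$ with a $\mathcal P(\mathcal S)$-valued relation $[x\sim y]$ for which symmetry and transitivity are realized, and its morphisms are the functional relations (strict, relational, single-valued, total $\mathcal P(\mathcal S)$-valued relations, where each property has a realizer uniform in the elements), up to mutual entailment. A set $X$ with a nonempty $E(x)\subseteq\mathcal S$ for every $x\in X$ (an assembly) is regarded as an object of $\mathsf{RT}(\mathcal S)$ by $[x\sim y]=E(x)$ if $x=y$ and $[x\sim y]=\emptyset$ otherwise. Consider the assemblies - $\Sigma=(\{0,1\},E)$ with $E(0)=\{\emptyset\}$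 and $E(1)=\{\{1\}\}$ (the Sierpiński object); - $S=(\mathcal P(\mathbb N),E)$ with $E(U)=\{U\}$ (the object of realizers); - $N=(\mathbb N,E)$ with $E(n)=\{\{n\}\}$. Then $N$ is a natural numbers object of $\mathsf{RT}(\mathcal S)$ (for suitable morphisms $1\to N\to N$), the exponential $\Sigma^N$ exists in $\mathsf{RT}(\mathcal S)$, and $S\cong\Sigma^N$; that is, every object with an evaluation map having the universal property of the exponential $\Sigma^N$ is isomorphic to $S$. -/

import Mathlib

open CategoryTheory Limits MonoidalCategory

namespace ScottRealizability

/-! ### The graph model `𝒫(ℕ)` -/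

/-- Application in the graph model, `UV = {n | ∃ m, e_m ⊆ V ∧ ⟨m, n⟩ ∈ U}`, for a bijection
`c = ⟨·,·⟩ : ℕ × ℕ ≃ ℕ`. Here `e_m = Finset.equivBitIndices m` is the finite set
`{k₁, …, kᵣ}` with `m = 2 ^ k₁ + ⋯ + 2 ^ kᵣ`. -/
def app (c : ℕ × ℕ ≃ ℕ) (U V : Set ℕ) : Set ℕ :=
  {n | ∃ m, (↑(Finset.equivBitIndices m) : Set ℕ) ⊆ V ∧ c (m, n) ∈ U}

/-- The pairing `p U V = {2n | n ∈ U} ∪ {2n + 1 | n ∈ V}`. -/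
def pair (U V : Set ℕ) : Set ℕ := {k | (∃ n ∈ U, k = 2 * n) ∨ (∃ n ∈ V, k = 2 * n + 1)}

/-- The first unpairing `p₀`. -/
def fst (W : Set ℕ) : Set ℕ := {n | 2 * n ∈ W}

/-- The second unpairing `p₁`. -/
def snd (W : Set ℕ) : Set ℕ := {n | 2 * n + 1 ∈ W}

@[simp] lemma fst_pair (U V : Set ℕ) : fst (pair U V) = U := by
  ext n
  simp only [fst, pair, Set.mem_ofPred_eq]
  constructor
  · rintro (⟨m, hm, h⟩ | ⟨m, hm, h⟩)
    · obtain rfl : n = m := by omega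
      exact hm
    · omega
  · exact fun h => Or.inl ⟨n, h, rfl⟩

@[simp] lemma snd_pair (U V : Set ℕ) : snd (pair U V) = V := by
  ext n
  simp only [snd, pair, Set.mem_ofPred_eq]
  constructor
  · rintro (⟨m, hm, h⟩ | ⟨m, hm, h⟩)
    · omega
    · obtain rfl : n = m := by omega
      exact hm
  · exact fun h => Or.inr ⟨n, h, rfl⟩

/-- Continuity of `F : 𝒫(ℕ) → 𝒫(ℕ)` for the topology with basic opens `{U | p ⊆ U}`,
`p` finite. -/
@[fun_prop]
def Cont (F : Set ℕ → Set ℕ) : Prop :=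
  ∀ U n, n ∈ F U → ∃ p : Finset ℕ, (↑p : Set ℕ) ⊆ U ∧ ∀ V : Set ℕ, (↑p : Set ℕ) ⊆ V → n ∈ F V

@[fun_prop] lemma cont_id : Cont (fun U => U) := fun _ n hn =>
  ⟨{n}, by simpa using hn, fun _ h => by simpa using h⟩

@[fun_prop] lemma cont_const (A : Set ℕ) : Cont (fun _ => A) := fun _ _ hn =>
  ⟨∅, by simp, fun _ _ => hn⟩

lemma Cont.finite {F : Set ℕ → Set ℕ} (hF : Cont F) {U : Set ℕ} (q : Finset ℕ)
    (hq : (↑q : Set ℕ) ⊆ F U) :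
    ∃ p : Finset ℕ, (↑p : Set ℕ) ⊆ U ∧ ∀ V : Set ℕ, (↑p : Set ℕ) ⊆ V → (↑q : Set ℕ) ⊆ F V := by
  classical
  induction q using Finset.induction_on with
  | empty => exact ⟨∅, by simp, fun _ _ => by simp⟩
  | insert a q _ ih =>
    rw [Finset.coe_insert, Set.insert_subset_iff] at hq
    obtain ⟨p, hp, h⟩ := ih hq.2
    obtain ⟨p', hp', h'⟩ := hF U a hq.1
    refine ⟨p ∪ p', by simp [hp, hp'], fun V hV => ?_⟩
    rw [Finset.coe_union, Set.union_subset_iff] at hV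
    rw [Finset.coe_insert, Set.insert_subset_iff]
    exact ⟨h' V hV.2, h V hV.1⟩

@[fun_prop] lemma Cont.comp {F G : Set ℕ → Set ℕ} (hF : Cont F) (hG : Cont G) :
    Cont (fun U => F (G U)) := by
  intro U n hn
  obtain ⟨q, hq, h⟩ := hF _ n hn
  obtain ⟨p, hp, h'⟩ := hG.finite q hq
  exact ⟨p, hp, fun V hV => h _ (h' V hV)⟩

@[fun_prop] lemma Cont.app (c : ℕ × ℕ ≃ ℕ) {F G : Set ℕ → Set ℕ} (hF : Cont F) (hG : Cont G) :
    Cont (fun U => app c (F U) (G U)) := by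
  classical
  rintro U n ⟨m, hm, hn⟩
  obtain ⟨p, hp, h⟩ := hG.finite _ hm
  obtain ⟨p', hp', h'⟩ := hF U _ hn
  refine ⟨p ∪ p', by simp [hp, hp'], fun V hV => ?_⟩
  rw [Finset.coe_union, Set.union_subset_iff] at hV
  exact ⟨m, h V hV.1, h' V hV.2⟩

@[fun_prop] lemma cont_fst : Cont fst := fun _ n hn =>
  ⟨{2 * n}, by simpa [fst] using hn, fun _ h => by simpa [fst] using h⟩

@[fun_prop] lemma cont_snd : Cont snd := fun _ n hn =>
  ⟨{2 * n + 1}, by simpa [snd] using hn, fun _ h => by simpa [snd] using h⟩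

@[fun_prop] lemma Cont.pair {F G : Set ℕ → Set ℕ} (hF : Cont F) (hG : Cont G) :
    Cont (fun U => pair (F U) (G U)) := by
  rintro U n (⟨m, hm, rfl⟩ | ⟨m, hm, rfl⟩)
  · obtain ⟨p, hp, h⟩ := hF U m hm
    exact ⟨p, hp, fun V hV => Or.inl ⟨m, h V hV, rfl⟩⟩
  · obtain ⟨p, hp, h⟩ := hG U m hm
    exact ⟨p, hp, fun V hV => Or.inr ⟨m, h V hV, rfl⟩⟩

/-- Every continuous function is application of its graph `{⟨m, n⟩ | n ∈ F(e_m)}`. -/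
lemma Cont.exists_app (c : ℕ × ℕ ≃ ℕ) {F : Set ℕ → Set ℕ} (hF : Cont F) :
    ∃ U, ∀ V, ScottRealizability.app c U V = F V := by
  refine ⟨{k | (c.symm k).2 ∈ F (↑(Finset.equivBitIndices (c.symm k).1) : Set ℕ)}, fun V => ?_⟩
  ext n
  simp only [ScottRealizability.app, Set.mem_ofPred_eq, Equiv.symm_apply_apply]
  constructor
  · rintro ⟨m, hm, hn⟩
    obtain ⟨p, hp, h⟩ := hF _ n hn
    exact h V (hp.trans hm)
  · intro hn
    obtain ⟨p, hp, h⟩ := hF _ n hn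
    refine ⟨Finset.equivBitIndices.symm p, by simpa using hp, ?_⟩
    rw [Equiv.apply_symm_apply]
    exact h _ subset_rfl

/-! ### Realizability logic -/

/-- Conjunction of propositions (sets of realizers). -/
def conj (A B : Set (Set ℕ)) : Set (Set ℕ) := {W | ∃ U ∈ A, ∃ V ∈ B, W = pair U V}

/-- Entailment of `𝒫(𝒮)`-valued predicates on a set: some realizer sends, uniformly in `i`,
realizers of `φ i` to realizers of `ψ i`. -/
def Entails (c : ℕ × ℕ ≃ ℕ) {I : Type} (φ ψ : I → Set (Set ℕ)) : Prop :=
  ∃ U, ∀ i, ∀ V ∈ φ i, app c U V ∈ ψ i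

lemma Entails.of_cont {c : ℕ × ℕ ≃ ℕ} {I : Type} {φ ψ : I → Set (Set ℕ)}
    (F : Set ℕ → Set ℕ) (hF : Cont F) (h : ∀ i, ∀ V ∈ φ i, F V ∈ ψ i) : Entails c φ ψ := by
  obtain ⟨U, hU⟩ := hF.exists_app c
  exact ⟨U, fun i V hV => by rw [hU]; exact h i V hV⟩

/-! ### The realizability topos -/

/-- Objects of the realizability topos over the graph model: a set with a `𝒫(𝒮)`-valued
partial equivalence relation. -/
structure RT (c : ℕ × ℕ ≃ ℕ) where
  /-- The underlying set. -/
  carrier : Type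
  /-- The set of realizers of `x ∼ y`. -/
  eq : carrier → carrier → Set (Set ℕ)
  symm : Entails c (fun t : carrier × carrier => eq t.1 t.2) (fun t => eq t.2 t.1)
  trans : Entails c (fun t : carrier × carrier × carrier => conj (eq t.1 t.2.1) (eq t.2.1 t.2.2))
    (fun t => eq t.1 t.2.2)

variable {c : ℕ × ℕ ≃ ℕ}

/-- Functional relations between objects: strict, relational, single-valued and total
`𝒫(𝒮)`-valued relations. -/
structure FunRel (X Y : RT c) where
  /-- The set of realizers of `F(x, y)`. -/
  rel : X.carrier → Y.carrier → Set (Set ℕ)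
  strict : Entails c (fun t : X.carrier × Y.carrier => rel t.1 t.2)
    (fun t => conj (X.eq t.1 t.1) (Y.eq t.2 t.2))
  ext : Entails c
    (fun t : (X.carrier × X.carrier) × (Y.carrier × Y.carrier) =>
      conj (rel t.1.1 t.2.1) (conj (X.eq t.1.1 t.1.2) (Y.eq t.2.1 t.2.2)))
    (fun t => rel t.1.2 t.2.2)
  single : Entails c
    (fun t : X.carrier × Y.carrier × Y.carrier => conj (rel t.1 t.2.1) (rel t.1 t.2.2))
    (fun t => Y.eq t.2.1 t.2.2)
  total : Entails c (fun x : X.carrier => X.eq x x) (fun x => ⋃ y, rel x y)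

/-- The order on functional relations given by entailment. -/
def FunRel.Le {X Y : RT c} (F G : FunRel X Y) : Prop :=
  Entails c (fun t : X.carrier × Y.carrier => F.rel t.1 t.2) (fun t => G.rel t.1 t.2)

lemma FunRel.Le.refl {X Y : RT c} (F : FunRel X Y) : F.Le F :=
  Entails.of_cont (fun w => w) (by fun_prop) (fun _ _ h => h)

lemma FunRel.Le.trans {X Y : RT c} {F G H : FunRel X Y} (h : F.Le G) (h' : G.Le H) : F.Le H := by
  obtain ⟨r, hr⟩ := h
  obtain ⟨s, hs⟩ := h'
  exact Entails.of_cont (fun w => app c s (app c r w)) (by fun_prop)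
    (fun i V hV => hs i _ (hr i V hV))

/-- For functional relations, entailment in one direction implies entailment in the other. -/
lemma FunRel.Le.symm {X Y : RT c} {F G : FunRel X Y} (h : F.Le G) : G.Le F := by
  obtain ⟨r, hr⟩ := h
  obtain ⟨gs, hgs⟩ := G.strict
  obtain ⟨ft, hft⟩ := F.total
  obtain ⟨g1, hg1⟩ := G.single
  obtain ⟨fe, hfe⟩ := F.ext
  refine Entails.of_cont (fun w =>
    app c fe (pair (app c ft (fst (app c gs w)))
      (pair (fst (app c gs w))
        (app c g1 (pair (app c r (app c ft (fst (app c gs w)))) w))))) (by fun_prop) ?_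
  rintro ⟨x, y⟩ w hw
  obtain ⟨a, ha, b, hb, hab⟩ := hgs (x, y) w hw
  simp only [hab, fst_pair]
  obtain ⟨y', hy'⟩ := Set.mem_iUnion.1 (hft x a ha)
  exact hfe ((x, x), (y', y)) _ ⟨_, hy', _, ⟨_, ha, _,
    hg1 (x, y', y) _ ⟨_, hr (x, y') _ hy', _, hw, rfl⟩, rfl⟩, rfl⟩

/-- Two functional relations are identified when they entail each other. -/
instance FunRel.setoid (X Y : RT c) : Setoid (FunRel X Y) where
  r F G := F.Le G ∧ G.Le F
  iseqv :=
    { refl := fun F => ⟨.refl F, .refl F⟩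
      symm := fun h => ⟨h.2, h.1⟩
      trans := fun h h' => ⟨h.1.trans h'.1, h'.2.trans h.2⟩ }

lemma FunRel.equiv_of_le {X Y : RT c} {F G : FunRel X Y} (h : F.Le G) : F ≈ G := ⟨h, h.symm⟩

/-- The identity, given by the relation `∼`. -/
def FunRel.id (X : RT c) : FunRel X X where
  rel := X.eq
  strict := by
    obtain ⟨s, hs⟩ := X.symm
    obtain ⟨t, ht⟩ := X.trans
    refine Entails.of_cont (fun w => pair (app c t (pair w (app c s w)))
      (app c t (pair (app c s w) w))) (by fun_prop) ?_
    rintro ⟨x, y⟩ w hw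
    exact ⟨_, ht (x, y, x) _ ⟨_, hw, _, hs (x, y) _ hw, rfl⟩, _,
      ht (y, x, y) _ ⟨_, hs (x, y) _ hw, _, hw, rfl⟩, rfl⟩
  ext := by
    obtain ⟨s, hs⟩ := X.symm
    obtain ⟨t, ht⟩ := X.trans
    refine Entails.of_cont (fun w => app c t (pair (app c s (fst (snd w)))
      (app c t (pair (fst w) (snd (snd w)))))) (by fun_prop) ?_
    rintro ⟨⟨x, x'⟩, ⟨y, y'⟩⟩ w ⟨a, ha, _, ⟨b, hb, d, hd, rfl⟩, rfl⟩
    simp only [fst_pair, snd_pair]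
    exact ht (x', x, y') _ ⟨_, hs (x, x') _ hb, _, ht (x, y, y') _ ⟨_, ha, _, hd, rfl⟩, rfl⟩
  single := by
    obtain ⟨s, hs⟩ := X.symm
    obtain ⟨t, ht⟩ := X.trans
    refine Entails.of_cont (fun w => app c t (pair (app c s (fst w)) (snd w))) (by fun_prop) ?_
    rintro ⟨x, y, y'⟩ w ⟨a, ha, b, hb, rfl⟩
    simp only [fst_pair, snd_pair]
    exact ht (y, x, y') _ ⟨_, hs (x, y) _ ha, _, hb, rfl⟩
  total := Entails.of_cont (fun w => w) (by fun_prop) (fun x _ hw => Set.mem_iUnion.2 ⟨x, hw⟩)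

/-- Composition: `(G ∘ F)(x, z)` is `∃ y, F(x, y) ∧ G(y, z)`. -/
def FunRel.comp {X Y Z : RT c} (F : FunRel X Y) (G : FunRel Y Z) : FunRel X Z where
  rel x z := ⋃ y, conj (F.rel x y) (G.rel y z)
  strict := by
    obtain ⟨r, hr⟩ := F.strict
    obtain ⟨s, hs⟩ := G.strict
    refine Entails.of_cont (fun w => pair (fst (app c r (fst w))) (snd (app c s (snd w))))
      (by fun_prop) ?_
    rintro ⟨x, z⟩ w hw
    obtain ⟨y, a, ha, b, hb, rfl⟩ := Set.mem_iUnion.1 hw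
    obtain ⟨a₁, ha₁, _, _, h₁⟩ := hr (x, y) _ ha
    obtain ⟨_, _, a₂, ha₂, h₂⟩ := hs (y, z) _ hb
    simp only [fst_pair, snd_pair, h₁, h₂]
    exact ⟨_, ha₁, _, ha₂, rfl⟩
  ext := by
    obtain ⟨r, hr⟩ := F.strict
    obtain ⟨f, hf⟩ := F.ext
    obtain ⟨g, hg⟩ := G.ext
    refine Entails.of_cont (fun w => pair
      (app c f (pair (fst (fst w))
        (pair (fst (snd w)) (snd (app c r (fst (fst w)))))))
      (app c g (pair (snd (fst w))
        (pair (snd (app c r (fst (fst w)))) (snd (snd w)))))) (by fun_prop) ?_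
    rintro ⟨⟨x, x'⟩, ⟨z, z'⟩⟩ w ⟨_, hw, _, ⟨d, hd, e, he, rfl⟩, rfl⟩
    obtain ⟨y, a, ha, b, hb, rfl⟩ := Set.mem_iUnion.1 hw
    obtain ⟨_, _, q, hq, h₁⟩ := hr (x, y) _ ha
    simp only [fst_pair, snd_pair, h₁]
    exact Set.mem_iUnion.2 ⟨y, _, hf ((x, x'), (y, y)) _ ⟨_, ha, _, ⟨_, hd, _, hq, rfl⟩, rfl⟩,
      _, hg ((y, y), (z, z')) _ ⟨_, hb, _, ⟨_, hq, _, he, rfl⟩, rfl⟩, rfl⟩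
  single := by
    obtain ⟨f, hf⟩ := F.single
    obtain ⟨s, hs⟩ := G.strict
    obtain ⟨g, hg⟩ := G.ext
    obtain ⟨g', hg'⟩ := G.single
    refine Entails.of_cont (fun w => app c g' (pair
      (app c g (pair (snd (fst w)) (pair (app c f (pair (fst (fst w)) (fst (snd w))))
        (snd (app c s (snd (fst w)))))))
      (snd (snd w)))) (by fun_prop) ?_
    rintro ⟨x, z, z'⟩ w ⟨_, hw, _, hw', rfl⟩
    obtain ⟨y, a, ha, b, hb, rfl⟩ := Set.mem_iUnion.1 hw
    obtain ⟨y', a', ha', b', hb', rfl⟩ := Set.mem_iUnion.1 hw'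
    obtain ⟨_, _, q, hq, h₁⟩ := hs (y, z) _ hb
    simp only [fst_pair, snd_pair, h₁]
    exact hg' (y', z, z') _ ⟨_, hg ((y, y'), (z, z)) _ ⟨_, hb, _,
      ⟨_, hf (x, y, y') _ ⟨_, ha, _, ha', rfl⟩, _, hq, rfl⟩, rfl⟩, _, hb', rfl⟩
  total := by
    obtain ⟨f, hf⟩ := F.total
    obtain ⟨r, hr⟩ := F.strict
    obtain ⟨g, hg⟩ := G.total
    refine Entails.of_cont (fun w => pair (app c f w)
      (app c g (snd (app c r (app c f w))))) (by fun_prop) ?_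
    intro x w hw
    obtain ⟨y, hy⟩ := Set.mem_iUnion.1 (hf x w hw)
    obtain ⟨_, _, q, hq, h₁⟩ := hr (x, y) _ hy
    obtain ⟨z, hz⟩ := Set.mem_iUnion.1 (hg y q hq)
    simp only [snd_pair, h₁]
    exact Set.mem_iUnion.2 ⟨z, Set.mem_iUnion.2 ⟨y, _, hy, _, hz, rfl⟩⟩

lemma FunRel.comp_le {X Y Z : RT c} {F F' : FunRel X Y} {G G' : FunRel Y Z}
    (h : F.Le F') (h' : G.Le G') : (F.comp G).Le (F'.comp G') := by
  obtain ⟨r, hr⟩ := h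
  obtain ⟨s, hs⟩ := h'
  refine Entails.of_cont (fun w => pair (app c r (fst w)) (app c s (snd w))) (by fun_prop) ?_
  rintro ⟨x, z⟩ w hw
  obtain ⟨y, a, ha, b, hb, rfl⟩ := Set.mem_iUnion.1 hw
  simp only [fst_pair, snd_pair]
  exact Set.mem_iUnion.2 ⟨y, _, hr (x, y) _ ha, _, hs (y, z) _ hb, rfl⟩

/-- The realizability topos: morphisms are functional relations up to logical equivalence. -/
instance : Category (RT c) where
  Hom X Y := Quotient (FunRel.setoid X Y)
  id X := Quotient.mk _ (FunRel.id X)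
  comp := Quotient.map₂ FunRel.comp
    (fun _ _ h _ _ h' => ⟨FunRel.comp_le h.1 h'.1, FunRel.comp_le h.2 h'.2⟩)
  id_comp := by
    rintro X Y ⟨F⟩
    refine Quotient.sound (FunRel.equiv_of_le (FunRel.Le.symm ?_))
    obtain ⟨r, hr⟩ := F.strict
    refine Entails.of_cont (fun w => pair (fst (app c r w)) w) (by fun_prop) ?_
    rintro ⟨x, y⟩ w hw
    obtain ⟨a, ha, _, _, h₁⟩ := hr (x, y) _ hw
    simp only [fst_pair, h₁]
    exact Set.mem_iUnion.2 ⟨x, _, ha, _, hw, rfl⟩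
  comp_id := by
    rintro X Y ⟨F⟩
    refine Quotient.sound (FunRel.equiv_of_le (FunRel.Le.symm ?_))
    obtain ⟨r, hr⟩ := F.strict
    refine Entails.of_cont (fun w => pair w (snd (app c r w))) (by fun_prop) ?_
    rintro ⟨x, y⟩ w hw
    obtain ⟨_, _, a, ha, h₁⟩ := hr (x, y) _ hw
    simp only [snd_pair, h₁]
    exact Set.mem_iUnion.2 ⟨y, _, hw, _, ha, rfl⟩
  assoc := by
    rintro X Y Z W ⟨F⟩ ⟨G⟩ ⟨H⟩
    refine Quotient.sound (FunRel.equiv_of_le ?_)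
    refine Entails.of_cont (fun w => pair (fst (fst w)) (pair (snd (fst w)) (snd w)))
      (by fun_prop) ?_
    rintro ⟨x, z⟩ w hw
    obtain ⟨y, _, hv, b, hb, rfl⟩ := Set.mem_iUnion.1 hw
    obtain ⟨y', a, ha, d, hd, rfl⟩ := Set.mem_iUnion.1 hv
    simp only [fst_pair, snd_pair]
    exact Set.mem_iUnion.2 ⟨y', _, ha, _, Set.mem_iUnion.2 ⟨y, _, hd, _, hb, rfl⟩, rfl⟩

/-- The morphism represented by a functional relation. -/
def FunRel.hom {X Y : RT c} (F : FunRel X Y) : X ⟶ Y := Quotient.mk _ F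

lemma FunRel.hom_comp {X Y Z : RT c} (F : FunRel X Y) (G : FunRel Y Z) :
    F.hom ≫ G.hom = (F.comp G).hom := rfl

lemma FunRel.hom_eq {X Y : RT c} {F G : FunRel X Y} (h : F.Le G) : F.hom = G.hom :=
  Quotient.sound (FunRel.equiv_of_le h)

lemma FunRel.hom_eq_iff {X Y : RT c} {F G : FunRel X Y} : F.hom = G.hom ↔ F.Le G :=
  ⟨fun h => (Quotient.exact h).1, FunRel.hom_eq⟩

lemma exists_hom {X Y : RT c} (f : X ⟶ Y) : ∃ F : FunRel X Y, F.hom = f := Quotient.exists_rep f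

/-! ### Finite products -/

/-- The terminal object: one point, with every element of `𝒮` realizing `∗ ∼ ∗`. -/
def terminal (c : ℕ × ℕ ≃ ℕ) : RT c where
  carrier := Unit
  eq _ _ := Set.univ
  symm := ⟨∅, fun _ _ _ => Set.mem_univ _⟩
  trans := ⟨∅, fun _ _ _ => Set.mem_univ _⟩

/-- The functional relation to the terminal object. -/
def FunRel.toTerminal (X : RT c) : FunRel X (terminal c) where
  rel x _ := X.eq x x
  strict := by
    refine Entails.of_cont (fun w => pair w ∅) (by fun_prop) ?_
    exact fun t w hw => ⟨_, hw, _, Set.mem_univ _, rfl⟩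
  ext := by
    obtain ⟨r, hr⟩ := (FunRel.id X).strict
    refine Entails.of_cont (fun w => snd (app c r (fst (snd w)))) (by fun_prop) ?_
    rintro ⟨⟨x, x'⟩, _⟩ w ⟨a, ha, _, ⟨b, hb, d, hd, rfl⟩, rfl⟩
    obtain ⟨_, _, q, hq, h₁⟩ := hr (x, x') _ hb
    simp only [fst_pair, snd_pair, h₁]
    exact hq
  single := ⟨∅, fun _ _ _ => Set.mem_univ _⟩
  total := Entails.of_cont (fun w => w) (by fun_prop) (fun _ _ hw => Set.mem_iUnion.2 ⟨(), hw⟩)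

lemma FunRel.terminal_hom_ext {X : RT c} (f : X ⟶ terminal c) :
    f = (FunRel.toTerminal X).hom := by
  obtain ⟨F, rfl⟩ := exists_hom f
  apply FunRel.hom_eq
  obtain ⟨r, hr⟩ := F.strict
  refine Entails.of_cont (fun w => fst (app c r w)) (by fun_prop) ?_
  rintro ⟨x, u⟩ w hw
  obtain ⟨a, ha, _, _, h₁⟩ := hr (x, u) _ hw
  simp only [h₁, fst_pair]
  exact ha

/-- The product `X × Y`, with `(x, y) ∼ (x', y')` iff `x ∼ x' ∧ y ∼ y'`. -/
def prod (X Y : RT c) : RT c where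
  carrier := X.carrier × Y.carrier
  eq s t := conj (X.eq s.1 t.1) (Y.eq s.2 t.2)
  symm := by
    obtain ⟨r, hr⟩ := X.symm
    obtain ⟨s, hs⟩ := Y.symm
    refine Entails.of_cont (fun w => pair (app c r (fst w)) (app c s (snd w))) (by fun_prop) ?_
    rintro ⟨⟨x, y⟩, ⟨x', y'⟩⟩ w ⟨a, ha, b, hb, rfl⟩
    simp only [fst_pair, snd_pair]
    exact ⟨_, hr (x, x') _ ha, _, hs (y, y') _ hb, rfl⟩
  trans := by
    obtain ⟨r, hr⟩ := X.trans
    obtain ⟨s, hs⟩ := Y.trans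
    refine Entails.of_cont (fun w => pair (app c r (pair (fst (fst w)) (fst (snd w))))
      (app c s (pair (snd (fst w)) (snd (snd w))))) (by fun_prop) ?_
    rintro ⟨⟨x, y⟩, ⟨x', y'⟩, ⟨x'', y''⟩⟩ w ⟨_, ⟨a, ha, b, hb, rfl⟩, _, ⟨a', ha', b', hb', rfl⟩, rfl⟩
    simp only [fst_pair, snd_pair]
    exact ⟨_, hr (x, x', x'') _ ⟨_, ha, _, ha', rfl⟩, _,
      hs (y, y', y'') _ ⟨_, hb, _, hb', rfl⟩, rfl⟩

/-- The pairing `(a, (x, y)) ↦ F(a, x) ∧ G(a, y)` of functional relations. -/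
def FunRel.lift {A X Y : RT c} (F : FunRel A X) (G : FunRel A Y) : FunRel A (prod X Y) where
  rel a t := conj (F.rel a t.1) (G.rel a t.2)
  strict := by
    obtain ⟨r, hr⟩ := F.strict
    obtain ⟨s, hs⟩ := G.strict
    refine Entails.of_cont (fun w => pair (fst (app c r (fst w)))
      (pair (snd (app c r (fst w))) (snd (app c s (snd w))))) (by fun_prop) ?_
    rintro ⟨a, ⟨x, y⟩⟩ w ⟨u, hu, v, hv, rfl⟩
    obtain ⟨p, hp, q, hq, h₁⟩ := hr (a, x) _ hu
    obtain ⟨_, _, q', hq', h₂⟩ := hs (a, y) _ hv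
    simp only [fst_pair, snd_pair, h₁, h₂]
    exact ⟨_, hp, _, ⟨_, hq, _, hq', rfl⟩, rfl⟩
  ext := by
    obtain ⟨r, hr⟩ := F.ext
    obtain ⟨s, hs⟩ := G.ext
    refine Entails.of_cont (fun w => pair
      (app c r (pair (fst (fst w))
        (pair (fst (snd w)) (fst (snd (snd w))))))
      (app c s (pair (snd (fst w))
        (pair (fst (snd w)) (snd (snd (snd w)))))))
      (by fun_prop) ?_
    rintro ⟨⟨a, a'⟩, ⟨⟨x, y⟩, ⟨x', y'⟩⟩⟩ w
      ⟨_, ⟨u, hu, v, hv, rfl⟩, _, ⟨b, hb, _, ⟨d, hd, e, he, rfl⟩, rfl⟩, rfl⟩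
    simp only [fst_pair, snd_pair]
    exact ⟨_, hr ((a, a'), (x, x')) _ ⟨_, hu, _, ⟨_, hb, _, hd, rfl⟩, rfl⟩, _,
      hs ((a, a'), (y, y')) _ ⟨_, hv, _, ⟨_, hb, _, he, rfl⟩, rfl⟩, rfl⟩
  single := by
    obtain ⟨r, hr⟩ := F.single
    obtain ⟨s, hs⟩ := G.single
    refine Entails.of_cont (fun w => pair
      (app c r (pair (fst (fst w)) (fst (snd w))))
      (app c s (pair (snd (fst w)) (snd (snd w))))) (by fun_prop) ?_
    rintro ⟨a, ⟨x, y⟩, ⟨x', y'⟩⟩ w ⟨_, ⟨u, hu, v, hv, rfl⟩, _, ⟨u', hu', v', hv', rfl⟩, rfl⟩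
    simp only [fst_pair, snd_pair]
    exact ⟨_, hr (a, x, x') _ ⟨_, hu, _, hu', rfl⟩, _, hs (a, y, y') _ ⟨_, hv, _, hv', rfl⟩, rfl⟩
  total := by
    obtain ⟨r, hr⟩ := F.total
    obtain ⟨s, hs⟩ := G.total
    refine Entails.of_cont (fun w => pair (app c r w) (app c s w))
      (by fun_prop) ?_
    intro a w hw
    obtain ⟨x, hx⟩ := Set.mem_iUnion.1 (hr a w hw)
    obtain ⟨y, hy⟩ := Set.mem_iUnion.1 (hs a w hw)
    exact Set.mem_iUnion.2 ⟨(x, y), _, hx, _, hy, rfl⟩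

/-- The first projection, `((x, y), x') ↦ x ∼ x' ∧ y ∼ y`. -/
def FunRel.prodFst (X Y : RT c) : FunRel (prod X Y) X where
  rel t x := conj (X.eq t.1 x) (Y.eq t.2 t.2)
  strict := by
    obtain ⟨r, hr⟩ := (FunRel.id X).strict
    refine Entails.of_cont (fun w => pair
      (pair (fst (app c r (fst w))) (snd w)) (snd (app c r (fst w))))
      (by fun_prop) ?_
    rintro ⟨⟨x, y⟩, x'⟩ w ⟨u, hu, v, hv, rfl⟩
    obtain ⟨p, hp, q, hq, h₁⟩ := hr (x, x') _ hu
    simp only [fst_pair, snd_pair, h₁]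
    exact ⟨_, ⟨_, hp, _, hv, rfl⟩, _, hq, rfl⟩
  ext := by
    obtain ⟨r, hr⟩ := (FunRel.id X).ext
    obtain ⟨s, hs⟩ := (FunRel.id Y).strict
    refine Entails.of_cont (fun w => pair
      (app c r (pair (fst (fst w))
        (pair (fst (fst (snd w))) (snd (snd w)))))
      (snd (app c s (snd (fst (snd w)))))) (by fun_prop) ?_
    rintro ⟨⟨⟨x, y⟩, ⟨x', y'⟩⟩, ⟨z, z'⟩⟩ w
      ⟨_, ⟨u, hu, v, hv, rfl⟩, _, ⟨_, ⟨b, hb, d, hd, rfl⟩, e, he, rfl⟩, rfl⟩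
    obtain ⟨p, hp, q, hq, h₁⟩ := hs (y, y') _ hd
    simp only [fst_pair, snd_pair, h₁]
    exact ⟨_, hr ((x, x'), (z, z')) _ ⟨_, hu, _, ⟨_, hb, _, he, rfl⟩, rfl⟩, _, hq, rfl⟩
  single := by
    obtain ⟨r, hr⟩ := (FunRel.id X).single
    refine Entails.of_cont (fun w =>
      app c r (pair (fst (fst w)) (fst (snd w)))) (by fun_prop) ?_
    rintro ⟨⟨x, y⟩, z, z'⟩ w ⟨_, ⟨u, hu, v, hv, rfl⟩, _, ⟨u', hu', v', hv', rfl⟩, rfl⟩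
    simp only [fst_pair]
    simp only [snd_pair, fst_pair]
    exact hr (x, z, z') _ ⟨_, hu, _, hu', rfl⟩
  total := Entails.of_cont (fun w => w) (by fun_prop)
    (fun t _ hw => Set.mem_iUnion.2 ⟨t.1, hw⟩)

/-- The second projection, `((x, y), y') ↦ x ∼ x ∧ y ∼ y'`. -/
def FunRel.prodSnd (X Y : RT c) : FunRel (prod X Y) Y where
  rel t y := conj (X.eq t.1 t.1) (Y.eq t.2 y)
  strict := by
    obtain ⟨r, hr⟩ := (FunRel.id Y).strict
    refine Entails.of_cont (fun w => pair
      (pair (fst w) (fst (app c r (snd w)))) (snd (app c r (snd w))))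
      (by fun_prop) ?_
    rintro ⟨⟨x, y⟩, y'⟩ w ⟨u, hu, v, hv, rfl⟩
    obtain ⟨p, hp, q, hq, h₁⟩ := hr (y, y') _ hv
    simp only [fst_pair, snd_pair, h₁]
    exact ⟨_, ⟨_, hu, _, hp, rfl⟩, _, hq, rfl⟩
  ext := by
    obtain ⟨r, hr⟩ := (FunRel.id Y).ext
    obtain ⟨s, hs⟩ := (FunRel.id X).strict
    refine Entails.of_cont (fun w => pair
      (snd (app c s (fst (fst (snd w)))))
      (app c r (pair (snd (fst w))
        (pair (snd (fst (snd w))) (snd (snd w)))))) (by fun_prop) ?_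
    rintro ⟨⟨⟨x, y⟩, ⟨x', y'⟩⟩, ⟨z, z'⟩⟩ w
      ⟨_, ⟨u, hu, v, hv, rfl⟩, _, ⟨_, ⟨b, hb, d, hd, rfl⟩, e, he, rfl⟩, rfl⟩
    obtain ⟨p, hp, q, hq, h₁⟩ := hs (x, x') _ hb
    simp only [fst_pair, snd_pair, h₁]
    exact ⟨_, hq, _, hr ((y, y'), (z, z')) _ ⟨_, hv, _, ⟨_, hd, _, he, rfl⟩, rfl⟩, rfl⟩
  single := by
    obtain ⟨r, hr⟩ := (FunRel.id Y).single
    refine Entails.of_cont (fun w =>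
      app c r (pair (snd (fst w)) (snd (snd w)))) (by fun_prop) ?_
    rintro ⟨⟨x, y⟩, z, z'⟩ w ⟨_, ⟨u, hu, v, hv, rfl⟩, _, ⟨u', hu', v', hv', rfl⟩, rfl⟩
    simp only [fst_pair, snd_pair]
    exact hr (y, z, z') _ ⟨_, hv, _, hv', rfl⟩
  total := Entails.of_cont (fun w => w) (by fun_prop)
    (fun t _ hw => Set.mem_iUnion.2 ⟨t.2, hw⟩)

lemma FunRel.lift_le {A X Y : RT c} {F F' : FunRel A X} {G G' : FunRel A Y}
    (h : F.Le F') (h' : G.Le G') : (F.lift G).Le (F'.lift G') := by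
  obtain ⟨r, hr⟩ := h
  obtain ⟨s, hs⟩ := h'
  refine Entails.of_cont (fun w => pair (app c r (fst w)) (app c s (snd w))) (by fun_prop) ?_
  rintro ⟨a, ⟨x, y⟩⟩ w ⟨u, hu, v, hv, rfl⟩
  simp only [fst_pair, snd_pair]
  exact ⟨_, hr (a, x) _ hu, _, hs (a, y) _ hv, rfl⟩

lemma FunRel.lift_prodFst {A X Y : RT c} (F : FunRel A X) (G : FunRel A Y) :
    ((F.lift G).comp (FunRel.prodFst X Y)).Le F := by
  obtain ⟨r, hr⟩ := F.ext
  obtain ⟨s, hs⟩ := F.strict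
  refine Entails.of_cont (fun w => app c r (pair (fst (fst w))
    (pair (fst (app c s (fst (fst w)))) (fst (snd w))))) (by fun_prop) ?_
  rintro ⟨a, x'⟩ w hw
  obtain ⟨⟨x, y⟩, _, ⟨u, hu, v, hv, rfl⟩, _, ⟨b, hb, d, hd, rfl⟩, rfl⟩ := Set.mem_iUnion.1 hw
  obtain ⟨p, hp, _, _, h₁⟩ := hs (a, x) _ hu
  simp only [fst_pair, snd_pair, h₁]
  exact hr ((a, a), (x, x')) _ ⟨_, hu, _, ⟨_, hp, _, hb, rfl⟩, rfl⟩

lemma FunRel.lift_prodSnd {A X Y : RT c} (F : FunRel A X) (G : FunRel A Y) :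
    ((F.lift G).comp (FunRel.prodSnd X Y)).Le G := by
  obtain ⟨r, hr⟩ := G.ext
  obtain ⟨s, hs⟩ := G.strict
  refine Entails.of_cont (fun w => app c r (pair (snd (fst w))
    (pair (fst (app c s (snd (fst w)))) (snd (snd w))))) (by fun_prop) ?_
  rintro ⟨a, y'⟩ w hw
  obtain ⟨⟨x, y⟩, _, ⟨u, hu, v, hv, rfl⟩, _, ⟨b, hb, d, hd, rfl⟩, rfl⟩ := Set.mem_iUnion.1 hw
  obtain ⟨p, hp, _, _, h₁⟩ := hs (a, y) _ hv
  simp only [fst_pair, snd_pair, h₁]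
  exact hr ((a, a), (y, y')) _ ⟨_, hv, _, ⟨_, hp, _, hd, rfl⟩, rfl⟩

lemma FunRel.le_lift {A X Y : RT c} (H : FunRel A (prod X Y)) :
    H.Le ((H.comp (FunRel.prodFst X Y)).lift (H.comp (FunRel.prodSnd X Y))) := by
  obtain ⟨s, hs⟩ := H.strict
  refine Entails.of_cont (fun w => pair (pair w (snd (app c s w))) (pair w (snd (app c s w))))
    (by fun_prop) ?_
  rintro ⟨a, ⟨x, y⟩⟩ w hw
  obtain ⟨_, _, q, hq, h₁⟩ := hs (a, (x, y)) _ hw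
  simp only [snd_pair, h₁]
  exact ⟨_, Set.mem_iUnion.2 ⟨(x, y), _, hw, _, hq, rfl⟩, _,
    Set.mem_iUnion.2 ⟨(x, y), _, hw, _, hq, rfl⟩, rfl⟩

/-- The pairing of morphisms. -/
def homLift {A X Y : RT c} (f : A ⟶ X) (g : A ⟶ Y) : A ⟶ prod X Y :=
  Quotient.map₂ (sa := FunRel.setoid A X) (sb := FunRel.setoid A Y)
    (sc := FunRel.setoid A (prod X Y)) FunRel.lift
    (fun _ _ h _ _ h' => ⟨FunRel.lift_le h.1 h'.1, FunRel.lift_le h.2 h'.2⟩) f g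

lemma homLift_hom {A X Y : RT c} (F : FunRel A X) (G : FunRel A Y) :
    homLift F.hom G.hom = (F.lift G).hom := rfl

lemma homLift_fst {A X Y : RT c} (f : A ⟶ X) (g : A ⟶ Y) :
    homLift f g ≫ (FunRel.prodFst X Y).hom = f := by
  obtain ⟨F, rfl⟩ := exists_hom f
  obtain ⟨G, rfl⟩ := exists_hom g
  exact FunRel.hom_eq (FunRel.lift_prodFst F G)

lemma homLift_snd {A X Y : RT c} (f : A ⟶ X) (g : A ⟶ Y) :
    homLift f g ≫ (FunRel.prodSnd X Y).hom = g := by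
  obtain ⟨F, rfl⟩ := exists_hom f
  obtain ⟨G, rfl⟩ := exists_hom g
  exact FunRel.hom_eq (FunRel.lift_prodSnd F G)

lemma homLift_uniq {A X Y : RT c} (h : A ⟶ prod X Y) :
    h = homLift (h ≫ (FunRel.prodFst X Y).hom) (h ≫ (FunRel.prodSnd X Y).hom) := by
  obtain ⟨H, rfl⟩ := exists_hom h
  exact FunRel.hom_eq (FunRel.le_lift H)

/-- The cartesian structure of the realizability topos given by the products above. -/
noncomputable instance : CartesianMonoidalCategory (RT c) :=
  CartesianMonoidalCategory.ofChosenFiniteProducts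
    { cone := asEmptyCone (terminal c)
      isLimit := IsTerminal.ofUniqueHom (fun X => (FunRel.toTerminal X).hom)
        (fun _ f => FunRel.terminal_hom_ext f) }
    (fun X Y =>
      { cone := BinaryFan.mk (FunRel.prodFst X Y).hom (FunRel.prodSnd X Y).hom
        isLimit := BinaryFan.isLimitMk (fun s => homLift s.fst s.snd)
          (fun s => homLift_fst s.fst s.snd) (fun s => homLift_snd s.fst s.snd)
          (fun s m h₁ h₂ => by rw [← h₁, ← h₂]; exact homLift_uniq m) })

/-! ### Assemblies and the objects `Σ`, `S`, `N` -/

/-- The object of the topos given by an assembly `(X, E)`: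
`[x ∼ y]` is `E(x)` if `x = y`, and empty otherwise. -/
def ofAssembly (c : ℕ × ℕ ≃ ℕ) (X : Type) (E : X → Set (Set ℕ)) : RT c where
  carrier := X
  eq x y := {U | x = y ∧ U ∈ E x}
  symm := by
    refine Entails.of_cont (fun w => w) (by fun_prop) ?_
    rintro ⟨x, y⟩ w ⟨h, hw⟩
    obtain rfl : x = y := h
    exact ⟨rfl, hw⟩
  trans := by
    refine Entails.of_cont fst (by fun_prop) ?_
    rintro ⟨x, y, z⟩ w ⟨a, ⟨h, ha⟩, b, ⟨h', _⟩, rfl⟩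
    rw [fst_pair]
    exact ⟨h.trans h', ha⟩

/-- The Sierpiński object: `({0, 1}, E)` with `E(0) = {∅}` and `E(1) = {{1}}`. -/
def sierpinski (c : ℕ × ℕ ≃ ℕ) : RT c :=
  ofAssembly c (Fin 2) (fun i => if i = 0 then {∅} else {{1}})

/-- The object of realizers `S = (𝒫(ℕ), {-})`. -/
def realizers (c : ℕ × ℕ ≃ ℕ) : RT c := ofAssembly c (Set ℕ) (fun U => {U})

/-- The object `N = (ℕ, E)` with `E(n) = {{n}}`. -/
def natObj (c : ℕ × ℕ ≃ ℕ) : RT c := ofAssembly c ℕ (fun n => {{n}})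

end ScottRealizability

/-- `1 → N → N` is a natural numbers object in a category with finite products. -/
def IsNaturalNumbersObject {C : Type*} [Category C] [CartesianMonoidalCategory C]
    (N : C) (zero : 𝟙_ C ⟶ N) (succ : N ⟶ N) : Prop :=
  ∀ (X : C) (x : 𝟙_ C ⟶ X) (f : X ⟶ X), ∃! h : N ⟶ X, zero ≫ h = x ∧ succ ≫ h = h ≫ f

/-- `E` with `ev : X × E → Y` is an exponential `Y ^ X` in a category with finite products. -/
def IsExponential {C : Type*} [Category C] [CartesianMonoidalCategory C]
    (Y X E : C) (ev : X ⊗ E ⟶ Y) : Prop :=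
  ∀ (A : C) (f : X ⊗ A ⟶ Y), ∃! g : A ⟶ E, X ◁ g ≫ ev = f

namespace ScottRealizability

variable {c : ℕ × ℕ ≃ ℕ}

/-! ### Continuity of set-indexed operations -/

/-! Two features of the graph model carry the theorem: realizers may be any sets, computable or not,
and continuity of a set-valued map is tested one output element at a time.

For the natural numbers object: given an arbitrary external sequence of sets `u n`, the map sending
`W` to the union of the `u n` with `n ∈ W` is continuous and takes `{n}` to `u n` (`Cont.biUnion`).
Hence an entailment whose realizers determine a number `n` may be realized for each `n` separately,
with no uniformity in `n` (`Entails.of_nat`). So `N` is the countable copower of the terminal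
object: morphisms `N ⟶ X` correspond to arbitrary sequences of global elements of `X`
(`natObj_hom_ext`, `exists_natDesc`). The universal property is then ordinary recursion in the set
of global elements.

For the exponential: a morphism into an assembly is a function that respects `∼` and is tracked by a
continuous map, two such functions being identified when they agree on elements that have realizers
(`FunRel.exists_ofTracked`, `FunRel.hom_eq_ofTracked_iff`). A morphism from `N × A` to `Σ` is thus a
relation `φ (n, a) = 1`, whose transpose sends `a` to the set of all such `n`. This transpose is
tracked because each membership condition is continuous in the realizer of `a`; evaluation is the
membership predicate, and uniqueness is extensionality of sets. -/

@[fun_prop] lemma Cont.biUnion (u : ℕ → Set ℕ) {F : Set ℕ → Set ℕ} (hF : Cont F) :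
    Cont (fun W => ⋃ n ∈ F W, u n) := by
  intro W k hk
  obtain ⟨n, hn, hk⟩ := Set.mem_iUnion₂.1 hk
  obtain ⟨p, hp, h⟩ := hF W n hn
  exact ⟨p, hp, fun V hV => Set.mem_iUnion₂.2 ⟨n, h V hV, hk⟩⟩

/-- Each membership `n` involves only the single map `F n`, so no uniformity in `n` is needed. This
is what makes the transpose of a tracked map continuous. -/
lemma Cont.sections {F : ℕ → Set ℕ → Set ℕ} (hF : ∀ n, Cont (F n)) (k : ℕ) :
    Cont (fun W => {n | k ∈ F n W}) := fun W n hn => hF n W k hn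

lemma Cont.inter {F G : Set ℕ → Set ℕ} (hF : Cont F) (hG : Cont G) :
    Cont (fun W => F W ∩ G W) := by
  classical
  rintro W n ⟨h₁, h₂⟩
  obtain ⟨p, hp, h⟩ := hF W n h₁
  obtain ⟨q, hq, h'⟩ := hG W n h₂
  refine ⟨p ∪ q, by simp [hp, hq], fun V hV => ?_⟩
  rw [Finset.coe_union, Set.union_subset_iff] at hV
  exact ⟨h V hV.1, h' V hV.2⟩

/-! ### Elementary facts on the objects -/

lemma RT.eq_nonempty_symm (X : RT c) {x y : X.carrier} (h : (X.eq x y).Nonempty) :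
    (X.eq y x).Nonempty := by
  obtain ⟨s, hs⟩ := X.symm
  exact ⟨_, hs (x, y) _ h.some_mem⟩

lemma RT.eq_nonempty_left (X : RT c) {x y : X.carrier} (h : (X.eq x y).Nonempty) :
    (X.eq x x).Nonempty := by
  obtain ⟨s, hs⟩ := (FunRel.id X).strict
  obtain ⟨a, ha, -⟩ := hs (x, y) _ h.some_mem
  exact ⟨a, ha⟩

/-! ### Morphisms to assemblies are tracked functions -/

section Tracked

variable {X : RT c} {Y : Type} {E : Y → Set (Set ℕ)}

/-- The functional relation of a tracked function from an object to an assembly. -/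
def FunRel.ofTracked (φ : X.carrier → Y) (hφ : ∀ x x', (X.eq x x').Nonempty → φ x = φ x')
    (h : Entails c (fun x => X.eq x x) (fun x => E (φ x))) : FunRel X (ofAssembly c Y E) where
  -- A realizer of `x` is enough: a realizer of the value is recovered from it by the tracking map.
  rel x y := {w | w ∈ X.eq x x ∧ φ x = y}
  strict := by
    obtain ⟨u, hu⟩ := h
    refine Entails.of_cont (fun w => pair w (app c u w)) (by fun_prop) ?_
    rintro ⟨x, y⟩ w ⟨hw, hy⟩
    obtain rfl : φ x = y := hy
    exact ⟨_, hw, _, ⟨rfl, hu x w hw⟩, rfl⟩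
  ext := by
    obtain ⟨r, hr⟩ := (FunRel.id X).strict
    refine Entails.of_cont (fun w => snd (app c r (fst (snd w)))) (by fun_prop) ?_
    rintro ⟨⟨x, x'⟩, ⟨y, y'⟩⟩ w ⟨a, ⟨_, hxy⟩, _, ⟨b, hb, d, ⟨hyy, _⟩, rfl⟩, rfl⟩
    obtain ⟨_, _, q, hq, h₁⟩ := hr (x, x') _ hb
    simp only [fst_pair, snd_pair, h₁]
    exact ⟨hq, (hφ x x' ⟨b, hb⟩).symm.trans (hxy.trans hyy)⟩
  single := by
    obtain ⟨u, hu⟩ := h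
    refine Entails.of_cont (fun w => app c u (fst w)) (by fun_prop) ?_
    rintro ⟨x, y, y'⟩ w ⟨a, ⟨ha, hy⟩, _, ⟨_, hy'⟩, rfl⟩
    obtain rfl : φ x = y := hy
    simp only [fst_pair]
    exact ⟨hy', hu x a ha⟩
  total := Entails.of_cont (fun w => w) (by fun_prop)
    (fun x _ hw => Set.mem_iUnion.2 ⟨φ x, hw, rfl⟩)

/-- In an assembly `y ∼ y'` has a realizer only when `y = y'`, so single-valuedness becomes genuine
equality. -/
lemma FunRel.eq_of_nonempty (F : FunRel X (ofAssembly c Y E)) {x : X.carrier} {y y' : Y}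
    (h : (F.rel x y).Nonempty) (h' : (F.rel x y').Nonempty) : y = y' := by
  obtain ⟨s, hs⟩ := F.single
  exact (hs (x, y, y') _ ⟨_, h.some_mem, _, h'.some_mem, rfl⟩).1

/-- A functional relation to an assembly represents the same morphism as a tracked function
as soon as it is contained in the graph of that function. -/
lemma FunRel.hom_eq_ofTracked_iff {F : FunRel X (ofAssembly c Y E)} {φ : X.carrier → Y} {hφ h} :
    F.hom = (FunRel.ofTracked φ hφ h).hom ↔ ∀ x y, (F.rel x y).Nonempty → φ x = y := by
  constructor
  · intro hF x y hxy
    obtain ⟨r, hr⟩ := FunRel.hom_eq_iff.1 hF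
    exact (hr (x, y) _ hxy.some_mem).2
  · intro hF
    apply FunRel.hom_eq
    obtain ⟨s, hs⟩ := F.strict
    -- Between functional relations one entailment suffices, and strictness supplies the realizer of
    -- `x` that the graph requires.
    refine Entails.of_cont (fun w => fst (app c s w)) (by fun_prop) ?_
    rintro ⟨x, y⟩ w hw
    obtain ⟨a, ha, _, _, h₁⟩ := hs (x, y) w hw
    simp only [h₁, fst_pair]
    exact ⟨ha, hF x y ⟨w, hw⟩⟩

/-- A functional relation into an assembly is the graph of a function on the elements that have
realizers. Totality followed by strictness turns a realizer of `x` into one of its value, which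
gives the tracking map. -/
lemma FunRel.exists_ofTracked [Nonempty Y] (f : X ⟶ ofAssembly c Y E) :
    ∃ φ hφ h, f = (FunRel.ofTracked (X := X) (E := E) φ hφ h).hom := by
  obtain ⟨F, rfl⟩ := exists_hom f
  obtain ⟨s, hs⟩ := F.strict
  obtain ⟨t, ht⟩ := F.total
  obtain ⟨e, he⟩ := F.ext
  have key : ∀ x x' y, (X.eq x x').Nonempty → (F.rel x y).Nonempty → (F.rel x' y).Nonempty := by
    rintro x x' y ⟨a, ha⟩ ⟨w, hw⟩
    obtain ⟨_, _, b, hb, -⟩ := hs (x, y) w hw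
    exact ⟨_, he ((x, x'), (y, y)) _ ⟨_, hw, _, ⟨_, ha, _, hb, rfl⟩, rfl⟩⟩
  -- The value is arbitrary where `x` has no realizer. The choice depends only on the predicate of
  -- `y`, so related elements, which define the same predicate, receive the same value.
  let φ : X.carrier → Y := fun x => Classical.epsilon fun y : Y => (F.rel x y).Nonempty
  have spec : ∀ x y, (F.rel x y).Nonempty → φ x = y := fun x y hy =>
    F.eq_of_nonempty (Classical.epsilon_spec (p := fun y : Y => (F.rel x y).Nonempty) ⟨y, hy⟩) hy
  refine ⟨φ, fun x x' hx => ?_, ?_, FunRel.hom_eq_ofTracked_iff.2 spec⟩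
  · exact congrArg Classical.epsilon (funext fun y => propext
      ⟨key x x' y hx, key x' x y (X.eq_nonempty_symm hx)⟩)
  · refine Entails.of_cont (fun w => snd (app c s (app c t w))) (by fun_prop) ?_
    intro x w hw
    obtain ⟨y, hy⟩ := Set.mem_iUnion.1 (ht x w hw)
    obtain ⟨_, _, b, hb, h₁⟩ := hs (x, y) _ hy
    simp only [h₁, snd_pair, spec x y ⟨_, hy⟩]
    exact hb.2

end Tracked

/-! ### The object `N` is a countable copower of the terminal object -/

/-- Entailments may be realized separately for each value of a computable numerical parameter. -/
lemma Entails.of_nat {I : Type} {φ ψ : I → Set (Set ℕ)} (ν : I → ℕ)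
    (hν : Entails c φ (fun i => {{ν i}}))
    (h : ∀ n, ∃ U, ∀ i, ν i = n → ∀ V ∈ φ i, app c U V ∈ ψ i) : Entails c φ ψ := by
  obtain ⟨r, hr⟩ := hν
  choose u hu using h
  -- The realizers `u n` are glued into one continuous map; on a realizer for `i` the union runs
  -- over `{ν i}` alone and returns `u (ν i)`.
  refine Entails.of_cont (fun w => app c (⋃ n ∈ app c r w, u n) w) (by fun_prop) ?_
  intro i w hw
  have : app c r w = {ν i} := hr i w hw
  simp only [this, Set.mem_singleton_iff, Set.iUnion_iUnion_eq_left]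
  exact hu _ i rfl w hw

/-- The global element of `N` with value `n`. -/
def numeral (c : ℕ × ℕ ≃ ℕ) (n : ℕ) : terminal c ⟶ natObj c :=
  (FunRel.ofTracked (fun _ => n) (fun _ _ _ => rfl)
    (Entails.of_cont (fun _ => {n}) (by fun_prop) (fun _ _ _ => rfl))).hom

/-- The successor on `N`. -/
def natSucc (c : ℕ × ℕ ≃ ℕ) : natObj c ⟶ natObj c :=
  (FunRel.ofTracked (X := natObj c) (fun n : ℕ => n + 1)
    (fun _ _ ⟨_, h⟩ => congrArg (· + 1) h.1)
    (Entails.of_cont (fun w => ⋃ n ∈ w, {n + 1}) (by fun_prop) (by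
      rintro n w ⟨-, hw⟩
      obtain rfl : w = {n} := hw
      exact Set.biUnion_singleton n fun k : ℕ => {k + 1}))).hom

lemma numeral_succ (n : ℕ) : numeral c n ≫ natSucc c = numeral c (n + 1) := by
  refine FunRel.hom_eq_ofTracked_iff.2 fun x y hxy => ?_
  obtain ⟨w, hw⟩ := hxy
  obtain ⟨m, _, ⟨_, hm⟩, _, ⟨_, hy⟩, -⟩ := Set.mem_iUnion.1 hw
  exact (congrArg (· + 1) hm).trans hy

/-- Equality at each numeral gives one entailment per `n`, and `Entails.of_nat` glues them, since
strictness extracts `{n}` from a realizer of `F(n, y)`. -/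
lemma natObj_hom_ext {X : RT c} {f g : natObj c ⟶ X}
    (h : ∀ n, numeral c n ≫ f = numeral c n ≫ g) : f = g := by
  obtain ⟨F, rfl⟩ := exists_hom f
  obtain ⟨G, rfl⟩ := exists_hom g
  apply FunRel.hom_eq
  refine Entails.of_nat (fun t => t.1) ?_ fun n => ?_
  · obtain ⟨s, hs⟩ := F.strict
    refine Entails.of_cont (fun w => fst (app c s w)) (by fun_prop) ?_
    rintro ⟨n, y⟩ w hw
    obtain ⟨a, ha, _, _, h₁⟩ := hs (n, y) w hw
    simp only [h₁, fst_pair]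
    exact ha.2
  · obtain ⟨r, hr⟩ := FunRel.hom_eq_iff.1 (h n)
    -- Every set realizes the point of the terminal object, so `pair ∅ w` realizes the composite
    -- with `numeral c n` whenever `w` realizes `F(n, y)`.
    obtain ⟨U, hU⟩ := Cont.exists_app c (F := fun w => snd (app c r (pair ∅ w))) (by fun_prop)
    refine ⟨U, ?_⟩
    rintro ⟨m, y⟩ rfl w hw
    obtain ⟨k, a, ⟨_, hk⟩, b, hb, h₁⟩ := Set.mem_iUnion.1 (hr ((), y) (pair ∅ w)
      (Set.mem_iUnion.2 ⟨m, _, ⟨Set.mem_univ _, rfl⟩, _, hw, rfl⟩))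
    obtain rfl : m = k := hk
    rw [hU, h₁, snd_pair]
    exact hb

/-- The functional relation from `N` given by a sequence of global elements. -/
def FunRel.natDesc {X : RT c} (H : ℕ → FunRel (terminal c) X) : FunRel (natObj c) X where
  -- The component `{n}` lets the number be read off from a realizer, as `Entails.of_nat` requires.
  rel n y := conj {{n}} ((H n).rel () y)
  strict := by
    refine Entails.of_nat (fun t => t.1) ?_ fun n => ?_
    · refine Entails.of_cont fst (by fun_prop) ?_
      rintro ⟨n, y⟩ _ ⟨_, rfl, b, _, rfl⟩
      simp only [fst_pair]
      rfl
    · obtain ⟨s, hs⟩ := (H n).strict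
      obtain ⟨U, hU⟩ := Cont.exists_app c
        (F := fun w => pair (fst w) (snd (app c s (snd w)))) (by fun_prop)
      refine ⟨U, ?_⟩
      rintro ⟨n, y⟩ rfl _ ⟨_, rfl, b, hb, rfl⟩
      obtain ⟨_, _, d, hd, h₁⟩ := hs ((), y) b hb
      simp only [hU, fst_pair, snd_pair, h₁]
      exact ⟨_, ⟨rfl, rfl⟩, _, hd, rfl⟩
  ext := by
    refine Entails.of_nat (fun t => t.1.1) ?_ fun n => ?_
    · refine Entails.of_cont (fun w => fst (fst w)) (by fun_prop) ?_
      rintro ⟨⟨n, n'⟩, y, y'⟩ _ ⟨_, ⟨_, rfl, b, _, rfl⟩, _, _, rfl⟩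
      simp only [fst_pair]
      rfl
    · obtain ⟨e, he⟩ := (H n).ext
      obtain ⟨U, hU⟩ := Cont.exists_app c
        (F := fun w => pair (fst (fst w))
          (app c e (pair (snd (fst w)) (pair ∅ (snd (snd w)))))) (by fun_prop)
      refine ⟨U, ?_⟩
      rintro ⟨⟨n, n'⟩, y, y'⟩ rfl _ ⟨_, ⟨_, rfl, b, hb, rfl⟩, _, ⟨_, ⟨hn, _⟩, d, hd, rfl⟩, rfl⟩
      -- Distinct numbers are never related in `N`, so extensionality of the single relation `H n`
      -- suffices.
      obtain rfl : n = n' := hn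
      simp only [hU, fst_pair, snd_pair]
      exact ⟨_, rfl, _, he (((), ()), (y, y')) _
        ⟨_, hb, _, ⟨_, Set.mem_univ _, _, hd, rfl⟩, rfl⟩, rfl⟩
  single := by
    refine Entails.of_nat (fun t => t.1) ?_ fun n => ?_
    · refine Entails.of_cont (fun w => fst (fst w)) (by fun_prop) ?_
      rintro ⟨n, y, y'⟩ _ ⟨_, ⟨_, rfl, b, _, rfl⟩, _, _, rfl⟩
      simp only [fst_pair]
      rfl
    · obtain ⟨s, hs⟩ := (H n).single
      obtain ⟨U, hU⟩ := Cont.exists_app c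
        (F := fun w => app c s (pair (snd (fst w)) (snd (snd w)))) (by fun_prop)
      refine ⟨U, ?_⟩
      rintro ⟨n, y, y'⟩ rfl _ ⟨_, ⟨_, rfl, b, hb, rfl⟩, _, ⟨_, _, b', hb', rfl⟩, rfl⟩
      simp only [hU, snd_pair, fst_pair]
      exact hs ((), y, y') _ ⟨_, hb, _, hb', rfl⟩
  total := by
    refine Entails.of_nat (fun n => n) ?_ fun n => ?_
    · exact Entails.of_cont (fun w => w) (by fun_prop) fun n w hw => hw.2
    · obtain ⟨t, ht⟩ := (H n).total
      obtain ⟨U, hU⟩ := Cont.exists_app c (F := fun w => pair w (app c t ∅)) (by fun_prop)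
      refine ⟨U, ?_⟩
      rintro n rfl w ⟨_, hw⟩
      obtain ⟨y, hy⟩ := Set.mem_iUnion.1 (ht () ∅ (Set.mem_univ _))
      rw [hU]
      exact Set.mem_iUnion.2 ⟨y, _, hw, _, hy, rfl⟩

lemma exists_natDesc {X : RT c} (h : ℕ → (terminal c ⟶ X)) :
    ∃ f : natObj c ⟶ X, ∀ n, numeral c n ≫ f = h n := by
  choose H hH using fun n => exists_hom (h n)
  refine ⟨(FunRel.natDesc H).hom, fun n => ?_⟩
  rw [← hH n]
  apply FunRel.hom_eq
  refine Entails.of_cont (fun w => snd (snd w)) (by fun_prop) ?_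
  rintro ⟨⟨⟩, y⟩ w hw
  obtain ⟨m, _, ⟨_, hm⟩, _, ⟨_, _, b, hb, rfl⟩, rfl⟩ := Set.mem_iUnion.1 hw
  obtain rfl : n = m := hm
  simpa only [snd_pair] using hb

theorem isNaturalNumbersObject_natObj :
    IsNaturalNumbersObject (natObj c) (numeral c 0) (natSucc c) := by
  intro X x f
  -- The iterates of `f` on `x`, formed by external recursion; the copower property turns this
  -- sequence into a morphism.
  let h : ℕ → (terminal c ⟶ X) := fun n => Nat.rec x (fun _ g => g ≫ f) n
  obtain ⟨k, hk⟩ := exists_natDesc h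
  refine ⟨k, ⟨hk 0, natObj_hom_ext fun n => ?_⟩, ?_⟩
  · rw [← Category.assoc, numeral_succ, hk, ← Category.assoc, hk]
  · rintro k' ⟨h₀, h₁⟩
    refine natObj_hom_ext fun n => ?_
    rw [hk]
    induction n with
    | zero => exact h₀
    | succ n ih => rw [← numeral_succ, Category.assoc, h₁, ← Category.assoc, ih]

/-! ### The object of realizers is the exponential -/

/-- Provides an explicit functional relation for the whiskering, so that the exponential equation
can be tested on realizers. -/
lemma whiskerLeft_hom (X : RT c) {A B : RT c} (G : FunRel A B) :
    X ◁ G.hom = ((FunRel.prodFst X A).lift ((FunRel.prodSnd X A).comp G)).hom := by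
  rw [← homLift_hom, ← FunRel.hom_comp]
  refine (homLift_uniq (X ◁ G.hom)).trans (congrArg₂ homLift ?_ ?_)
  · exact CartesianMonoidalCategory.whiskerLeft_fst X G.hom
  · exact CartesianMonoidalCategory.whiskerLeft_snd X G.hom

open Classical in
lemma ite_eq_fin_two_iff {p : Prop} {i : Fin 2} : i = (if p then 1 else 0) ↔ (p ↔ i = 1) := by
  split_ifs with h
  · simp [h]
  · simp only [h, false_iff]
    omega

open Classical in
lemma biUnion_singleton_inter_mem (n : ℕ) (U : Set ℕ) :
    (⋃ k ∈ {n} ∩ U, ({1} : Set ℕ)) ∈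
      (if (if n ∈ U then (1 : Fin 2) else 0) = 0 then {∅} else {{1}} : Set (Set ℕ)) := by
  by_cases h : n ∈ U
  · rw [Set.inter_eq_self_of_subset_left (Set.singleton_subset_iff.2 h)]
    simp [h]
  · rw [Set.singleton_inter_eq_empty.2 h]
    simp [h]

open Classical in
/-- The evaluation `N × S → Σ`, the membership predicate. -/
noncomputable def realizersEval (c : ℕ × ℕ ≃ ℕ) : natObj c ⊗ realizers c ⟶ sierpinski c :=
  (FunRel.ofTracked (X := prod (natObj c) (realizers c))
    (fun t : ℕ × Set ℕ => if t.1 ∈ t.2 then (1 : Fin 2) else 0)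
    (by
      rintro ⟨n, U⟩ ⟨n', U'⟩ ⟨_, _, ⟨h, _⟩, _, ⟨h', _⟩, _⟩
      obtain rfl : n = n' := h
      obtain rfl : U = U' := h'
      rfl)
    -- On realizers `{n}` and `U` the intersection is `{n}` or empty according to whether `n ∈ U`,
    -- so the union is `{1}` or `∅`, the realizer of the truth value.
    (Entails.of_cont (fun w => ⋃ n ∈ fst w ∩ snd w, {1}) (by
        have := Cont.inter cont_fst cont_snd
        fun_prop) (by
      rintro ⟨n, U⟩ w ⟨a, ⟨_, ha⟩, b, ⟨_, hb⟩, rfl⟩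
      obtain rfl : a = {n} := ha
      obtain rfl : b = U := hb
      simp only [fst_pair, snd_pair]
      exact biUnion_singleton_inter_mem n b))).hom

/-- Both sides are morphisms into an assembly, so only their values on elements with realizers
matter. Every number has a realizer, which leaves a condition on `a` alone. -/
lemma whiskerLeft_realizersEval_iff {A : RT c} {γ : A.carrier → Set ℕ} {hγ h}
    {φ : ℕ × A.carrier → Fin 2} {hφ h'} :
    natObj c ◁ (FunRel.ofTracked (X := A) (E := fun U : Set ℕ => {U}) γ hγ h).hom ≫
        realizersEval c =
      (FunRel.ofTracked (X := prod (natObj c) A)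
        (E := fun i : Fin 2 => if i = 0 then {∅} else {{1}}) φ hφ h').hom ↔
      ∀ n a, (A.eq a a).Nonempty → (n ∈ γ a ↔ φ (n, a) = 1) := by
  classical
  rw [whiskerLeft_hom]
  refine FunRel.hom_eq_ofTracked_iff.trans ⟨fun H n a ⟨α, hα⟩ => ?_, fun H => ?_⟩
  -- The composite is realized at this value by taking `{n}` for `n`, `α` for `a`, and `γ a` as the
  -- realizer of itself.
  · have := H (n, a) (show Fin 2 from if n ∈ γ a then 1 else 0) ⟨_, Set.mem_iUnion.2 ⟨(n, γ a), _,
      ⟨_, ⟨{n}, ⟨rfl, rfl⟩, α, hα, rfl⟩, _, Set.mem_iUnion.2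
        ⟨a, _, ⟨{n}, ⟨rfl, rfl⟩, α, hα, rfl⟩, α, ⟨hα, rfl⟩, rfl⟩, rfl⟩, _,
      ⟨⟨{n}, ⟨rfl, rfl⟩, γ a, ⟨rfl, rfl⟩, rfl⟩, rfl⟩, rfl⟩⟩
    exact ite_eq_fin_two_iff.1 this
  · rintro ⟨n, a⟩ i ⟨w, hw⟩
    obtain ⟨⟨n', U⟩, _, ⟨_, ⟨_, ⟨hn, _⟩, _, _, _⟩, _, hs, _⟩, _, ⟨_, hi⟩, _⟩ :=
      Set.mem_iUnion.1 hw
    obtain ⟨a', _, ⟨_, _, α, hα, _⟩, _, ⟨_, hU⟩, _⟩ := Set.mem_iUnion.1 hs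
    obtain rfl : n = n' := hn
    obtain rfl : γ a' = U := hU
    change Fin 2 at i
    obtain rfl : (if (show ℕ from n) ∈ γ a' then (1 : Fin 2) else 0) = i := hi
    refine ite_eq_fin_two_iff.2 ?_
    -- The intermediate element `a'` of the composite is only related to `a`, not equal to it; `γ`
    -- identifies the two.
    rw [← hγ a a' ⟨α, hα⟩]
    exact H n a (A.eq_nonempty_left ⟨α, hα⟩)

theorem isExponential_realizers :
    IsExponential (sierpinski c) (natObj c) (realizers c) (realizersEval c) := by
  intro A f
  obtain ⟨φ, hφ, ⟨u, hu⟩, hf⟩ := FunRel.exists_ofTracked (X := prod (natObj c) A) (Y := Fin 2) f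
  let γ : A.carrier → Set ℕ := fun a => {n | φ (n, a) = 1}
  have hγ : ∀ a a', (A.eq a a').Nonempty → γ a = γ a' := by
    rintro a a' ⟨α, hα⟩
    ext n
    have := hφ (n, a) (n, a') ⟨_, {n}, ⟨rfl, rfl⟩, α, hα, rfl⟩
    simp only [γ, Set.mem_ofPred_eq, this]
  have hγt : Entails c (fun a => A.eq a a) (fun a => {γ a}) := by
    -- The tracker `u` returns `{1}` or `∅`, so testing whether its output at `n` contains `1`
    -- decides membership in `γ a`.
    refine Entails.of_cont (fun w => {n | 1 ∈ app c u (pair {n} w)})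
      (Cont.sections (fun n => by fun_prop) 1) ?_
    intro a α hα
    refine Set.mem_singleton_iff.2 (Set.ext fun n => ?_)
    have := hu (n, a) _ ⟨{n}, ⟨rfl, rfl⟩, α, hα, rfl⟩
    simp only [γ, Set.mem_ofPred_eq]
    by_cases h : φ (n, a) = 1
    · simp_all
    · have h0 : φ (n, a) = 0 := by omega
      simp_all
  refine ⟨(FunRel.ofTracked γ hγ hγt).hom, ?_, fun g hg => ?_⟩
  · rw [hf]
    exact whiskerLeft_realizersEval_iff.2 fun n a _ => Iff.rfl
  · obtain ⟨γ', hγ', h', rfl⟩ := FunRel.exists_ofTracked (X := A) (Y := Set ℕ) g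
    rw [hf] at hg
    refine FunRel.hom_eq_ofTracked_iff.2 ?_
    rintro a U ⟨α, hα, hU⟩
    rw [← hU]
    exact Set.ext fun n => ((whiskerLeft_realizersEval_iff.1 hg) n a ⟨α, hα⟩).symm

end ScottRealizability

/-! ### Uniqueness of exponentials -/

section

variable {C : Type*} [Category C] [CartesianMonoidalCategory C]

lemma IsExponential.hom_ext {Y X E A : C} {ev : X ⊗ E ⟶ Y} (h : IsExponential Y X E ev)
    {f g : A ⟶ E} (hfg : X ◁ f ≫ ev = X ◁ g ≫ ev) : f = g :=
  (h A (X ◁ g ≫ ev)).unique hfg rfl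

/-- Exponentials are unique up to isomorphism. -/
lemma IsExponential.nonempty_iso {Y X E E' : C} {ev : X ⊗ E ⟶ Y} {ev' : X ⊗ E' ⟶ Y}
    (h : IsExponential Y X E ev) (h' : IsExponential Y X E' ev') : Nonempty (E ≅ E') := by
  obtain ⟨f, hf, -⟩ := h' E ev
  obtain ⟨g, hg, -⟩ := h E' ev'
  -- Each round trip, like the identity, transposes the evaluation map, and transposes are unique.
  exact ⟨⟨f, g, h.hom_ext (by simp [hf, hg]), h'.hom_ext (by simp [hf, hg])⟩⟩

end

theorem mainTheorem3 (c : ℕ × ℕ ≃ ℕ) :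
    (∃ (zero : 𝟙_ (ScottRealizability.RT c) ⟶ ScottRealizability.natObj c) (succ : ScottRealizability.natObj c ⟶ ScottRealizability.natObj c),
      IsNaturalNumbersObject (ScottRealizability.natObj c) zero succ) ∧
    (∃ (E : ScottRealizability.RT c) (ev : ScottRealizability.natObj c ⊗ E ⟶ ScottRealizability.sierpinski c),
      IsExponential (ScottRealizability.sierpinski c) (ScottRealizability.natObj c) E ev) ∧
    ∀ (E : ScottRealizability.RT c) (ev : ScottRealizability.natObj c ⊗ E ⟶ ScottRealizability.sierpinski c),
      IsExponential (ScottRealizability.sierpinski c) (ScottRealizability.natObj c) E ev → Nonempty (ScottRealizability.realizers c ≅ E) := by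
  open ScottRealizability in
  exact ⟨⟨numeral c 0, natSucc c, isNaturalNumbersObject_natObj⟩,
    ⟨realizers c, realizersEval c, isExponential_realizers⟩,
    fun _ _ h => isExponential_realizers.nonempty_iso h⟩
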